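/- Let $\mathcal A=\{a,b\}$. For $w\in\mathcal A^*$ let $w^{(+)}$ be the shortest palindrome having $w$ as a prefix, and let $\psi:\mathcal A^*\to\mathcal A^*$ be the palindromization map, defined by $\psi(\varepsilon)=\varepsilon$ and $\psi(vx)=(\psi(v)x)^{(+)}$ for $v\in\mathcal A^*$, $x\in\mathcal A$. (The words $\psi(v)$ are the central words.) A positive integer $p$ is a period of $w=w_1\cdots w_m$ if $w_i=w_j$ whenever $1\le i,j\le m$ and $i\equiv j\pmod p$; let $\pi(w)$ be the minimal period of $w$ (so $\pi(\varepsilon)=1$). Every word $v\in\mathcal A^*$ can be written uniquely as $$v=b^{\alpha_0}a^{\alpha_1}b^{\alpha_2}\cdots x^{\alpha_n},\qquad n\ge 0,\ \alpha_0\ge 0,\ \alpha_i>0 \text{ for } 1\le i\le n,$$ with alternating letters ($x=b$ if $n$ is even, $x=a$ if $n$ is odd); the list $(\alpha_0,\alpha_1,\ldots,\alpha_n)$ is the integral representation of $v$ (for $v=\varepsilon$ it is $(0)$). The continuants are defined by $K[\ ]=1$, $K[c_0]=c_0$, and $K[c_0,\ldots,c_k]=c_k\,K[c_0,\ldots,c_{k-1}]+K[c_0,\ldots,c_{k-2}]$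 for $k\ge 1$. Proposition 5.5. If $v\in\mathcal A^*$ has the integral representation $(\alpha_0,\alpha_1,\ldots,\alpha_n)$, then $$\pi(\psi(v))=K[\alpha_0+1,\alpha_1,\ldots,\alpha_{n-1}],$$ where for $n=0$ the right-hand side is $K[\ ]=1$. -/

import Mathlib

namespace CentralWords

/-- The two-letter alphabet. -/
inductive Letter where
  | a : Letter
  | b : Letter
deriving DecidableEq

/-- Finite words over the alphabet. -/
abbrev Word := List Letter

/-! Periods of words. -/

/-- A period in the sense of `List.HasPeriod` is a `p` such that letters at positions congruent
modulo `p` are equal. -/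
theorem hasPeriod_iff_modEq (w : Word) (p : ℕ) :
    w.HasPeriod p ↔
      ∀ i j : ℕ, i < w.length → j < w.length → i ≡ j [MOD p] → w[i]? = w[j]? := by
  constructor
  · intro h i j hi hj hij
    rw [List.hasPeriod_iff_forall_getElem?_mod] at h
    rw [h i hi, h j hj, hij]
  · intro h
    rw [List.hasPeriod_iff_getElem?]
    intro i hi
    exact h i (i + p) (by omega) (by omega) (by simp [Nat.ModEq])

theorem exists_hasPeriod (w : Word) : ∃ p, 0 < p ∧ w.HasPeriod p :=
  ⟨w.length + 1, Nat.succ_pos _, List.hasPeriod_of_length_le _ _ (Nat.le_succ _)⟩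

open Classical in
/-- The minimal period of a word, i.e. its least positive period. -/
noncomputable def minPeriod (w : Word) : ℕ := Nat.find (exists_hasPeriod w)

/-- The usual convention for the empty word holds with this definition. -/
theorem minPeriod_nil : minPeriod [] = 1 := by
  classical
  unfold minPeriod
  rw [Nat.find_eq_iff]
  exact ⟨⟨one_pos, List.hasPeriod_empty 1⟩, fun m hm h => by have := h.1; omega⟩

/-! Palindromic closure and the palindromization map. -/

theorem exists_palindrome_drop (w : Word) : ∃ k, (w.drop k).Palindrome :=
  ⟨w.length, by rw [List.drop_length]; exact List.Palindrome.nil⟩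

/-- The right palindromic closure of `w`: if `w = u Q` with `Q` the longest palindromic suffix
of `w` (so that `u` has the least possible length `k`), this is `u Q u~ = w u~`. It is the shortest
palindrome with prefix `w`, see `isRightPalClosure_iff`. -/
def rightPalClosure (w : Word) : Word :=
  w ++ (w.take (Nat.find (exists_palindrome_drop w))).reverse

/-- `u` is a shortest palindrome having the prefix `w`. -/
def IsRightPalClosure (w u : Word) : Prop :=
  u.Palindrome ∧ w <+: u ∧ ∀ u' : Word, u'.Palindrome → w <+: u' → u.length ≤ u'.length

theorem rightPalClosure_palindrome (w : Word) : (rightPalClosure w).Palindrome := by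
  have h := (Nat.find_spec (exists_palindrome_drop w)).reverse_eq
  apply List.Palindrome.of_reverse_eq
  unfold rightPalClosure
  generalize Nat.find (exists_palindrome_drop w) = k at *
  obtain ⟨x, y, rfl, hx, hy⟩ : ∃ x y : Word, w = x ++ y ∧ w.take k = x ∧ w.drop k = y :=
    ⟨w.take k, w.drop k, (List.take_append_drop _ _).symm, rfl, rfl⟩
  rw [hy] at h
  rw [hx]
  simp [h]

theorem palindrome_prefix_short {w t : Word} (h : (w ++ t).Palindrome) (ht : t.length ≤ w.length) :
    t = (w.take t.length).reverse ∧ (w.drop t.length).Palindrome := by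
  have h1 := h.reverse_eq
  obtain ⟨x, y, rfl, hx⟩ : ∃ x y : Word, w = x ++ y ∧ x.length = t.length :=
    ⟨w.take t.length, w.drop t.length, (List.take_append_drop _ _).symm, by simp [ht]⟩
  simp only [List.reverse_append, List.append_assoc] at h1
  obtain ⟨h2, h3⟩ := List.append_inj h1 (by simp [hx])
  subst h2
  refine ⟨by simp, ?_⟩
  have h4 := (List.append_inj h3 (by simp)).1
  apply List.Palindrome.of_reverse_eq
  simpa using h4

theorem isRightPalClosure_iff (w u : Word) :
    IsRightPalClosure w u ↔ u = rightPalClosure w := by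
  have hpre : w <+: rightPalClosure w := List.prefix_append _ _
  have hk : Nat.find (exists_palindrome_drop w) ≤ w.length :=
    Nat.find_min' _ (by rw [List.drop_length]; exact List.Palindrome.nil)
  have hlen : (rightPalClosure w).length
      = w.length + Nat.find (exists_palindrome_drop w) := by
    simp [rightPalClosure, hk]
  have hmin : ∀ u' : Word, u'.Palindrome → w <+: u' →
      (rightPalClosure w).length ≤ u'.length := by
    rintro _ hp ⟨t, rfl⟩
    rw [hlen, List.length_append]
    by_cases ht : t.length ≤ w.length
    · have := Nat.find_min' (exists_palindrome_drop w) (palindrome_prefix_short hp ht).2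
      omega
    · omega
  constructor
  · rintro ⟨hp, ⟨t, rfl⟩, hm⟩
    have h1 := hm _ (rightPalClosure_palindrome w) hpre
    have h2 := hmin _ hp (List.prefix_append _ _)
    rw [hlen, List.length_append] at h1 h2
    have h3 : t.length = Nat.find (exists_palindrome_drop w) := by omega
    have h4 := (palindrome_prefix_short hp (by omega)).1
    rw [rightPalClosure, ← h3, ← h4]
  · rintro rfl
    exact ⟨rightPalClosure_palindrome w, hpre, hmin⟩

/-- The palindromization map: `ψ(ε) = ε` and `ψ(v x) = (ψ(v) x)⁽⁺⁾`. -/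
def psi (v : Word) : Word :=
  v.foldl (fun u x => rightPalClosure (u ++ [x])) []

theorem psi_nil : psi [] = [] := rfl

theorem psi_append_singleton (v : Word) (x : Letter) :
    psi (v ++ [x]) = rightPalClosure (psi v ++ [x]) := by
  simp [psi]

/-! Integral representations. -/

/-- The letter of the block with index `i` in `b^{α₀} a^{α₁} b^{α₂} ⋯`. -/
def blockLetter (i : ℕ) : Letter := if Even i then Letter.b else Letter.a

/-- `blockWord α n = b^{α₀} a^{α₁} b^{α₂} ⋯ x^{αₙ}`, with letters alternating. -/
def blockWord (α : ℕ → ℕ) : ℕ → Word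
  | 0 => List.replicate (α 0) (blockLetter 0)
  | n + 1 => blockWord α n ++ List.replicate (α (n + 1)) (blockLetter (n + 1))

/-- The list `(α₀, …, αₙ)` is the integral representation of `v`:
`v = b^{α₀} a^{α₁} b^{α₂} ⋯ x^{αₙ}`, where `α₀ ≥ 0` and all other exponents are positive.
(The empty word has the integral representation `(0)`.) The values `α i` for `i > n` play no
role. -/
def IsIntegralRepresentation (v : Word) (n : ℕ) (α : ℕ → ℕ) : Prop :=
  (∀ i, 1 ≤ i → i ≤ n → 0 < α i) ∧ v = blockWord α n

theorem blockWord_congr {α β : ℕ → ℕ} {n : ℕ} (h : ∀ i ≤ n, α i = β i) :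
    blockWord α n = blockWord β n := by
  induction n with
  | zero => simp [blockWord, h 0]
  | succ n ih => rw [blockWord, blockWord, ih fun i hi => h i (by omega), h (n + 1) le_rfl]

theorem blockWord_update_succ (α : ℕ → ℕ) (n : ℕ) :
    blockWord (Function.update α n (α n + 1)) n = blockWord α n ++ [blockLetter n] := by
  cases n with
  | zero => simp [blockWord, List.replicate_succ']
  | succ n =>
    rw [blockWord, blockWord, blockWord_congr (β := α) fun i hi => by
      rw [Function.update_of_ne (by omega)]]
    simp [List.replicate_succ']

/-- Every word has an integral representation. -/
theorem exists_integralRepresentation (v : Word) :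
    ∃ n α, IsIntegralRepresentation v n α := by
  induction v using List.reverseRecOn with
  | nil => exact ⟨0, fun _ => 0, fun i h1 h2 => by omega, rfl⟩
  | append_singleton v x ih =>
    obtain ⟨n, α, hpos, rfl⟩ := ih
    by_cases hx : x = blockLetter n
    · refine ⟨n, Function.update α n (α n + 1), fun i h1 h2 => ?_, ?_⟩
      · by_cases hi : i = n
        · simp [hi]
        · rw [Function.update_of_ne hi]; exact hpos i h1 h2
      · rw [blockWord_update_succ, hx]
    · have hx' : x = blockLetter (n + 1) := by
        unfold blockLetter at *
        cases x <;> by_cases hn : Even n <;> simp_all [Nat.even_add_one]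
      refine ⟨n + 1, Function.update α (n + 1) 1, fun i h1 h2 => ?_, ?_⟩
      · by_cases hi : i = n + 1
        · simp [hi]
        · rw [Function.update_of_ne hi]; exact hpos i h1 (by omega)
      · have h1 : blockWord (Function.update α (n + 1) 1) n = blockWord α n :=
          blockWord_congr fun i hi => Function.update_of_ne (by omega) _ _
        rw [blockWord, h1]
        simp [hx']

/-! Continuants. -/

/-- `continuant c k = K[c₀, …, c_{k-1}]`, the continuant of the first `k` terms of `c`:
`K[ ] = 1`, `K[c₀] = c₀`, and
`K[c₀, …, c_{k+1}] = c_{k+1} K[c₀, …, c_k] + K[c₀, …, c_{k-1}]`. -/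
def continuant (c : ℕ → ℕ) : ℕ → ℕ
  | 0 => 1
  | 1 => c 0
  | k + 2 => c (k + 1) * continuant c (k + 1) + continuant c k

end CentralWords

namespace CentralWords

/-- The value `p z` is `|u|` minus the length of the longest palindromic prefix of the palindrome
`u` that is followed by the letter `z`, and it is `|u| + 1` if `z` does not occur in `u`. -/
structure IsPeriodPair (u : Word) (p : Letter → ℕ) : Prop where
  palindrome : u.Palindrome
  pos : ∀ z, 0 < p z
  le : ∀ z, p z ≤ u.length + 1
  exists_prefix : ∀ z, p z ≤ u.length →
    ∃ P t : Word, u = P ++ z :: t ∧ P.Palindrome ∧ P.length + p z = u.length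
  maximal : ∀ z (P t : Word), u = P ++ z :: t → P.Palindrome → P.length + p z ≤ u.length

theorem IsPeriodPair.congr {u : Word} {p q : Letter → ℕ} (h : IsPeriodPair u p)
    (hpq : ∀ z, q z = p z) : IsPeriodPair u q :=
  (funext hpq : q = p) ▸ h

theorem isPeriodPair_nil : IsPeriodPair [] fun _ => 1 where
  palindrome := .nil
  pos _ := one_pos
  le _ := le_rfl
  exists_prefix _ h := by simp at h
  maximal _ P t h := by simp at h

/-- Reversing a palindrome with a factorization into a palindrome, a letter and a word. -/
theorem eq_reverse_append_of_palindrome {u P t : Word} {z : Letter} (hu : u.Palindrome)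
    (h : u = P ++ z :: t) (hP : P.Palindrome) : u = t.reverse ++ z :: P := by
  rw [← hu.reverse_eq, h]
  simp [hP.reverse_eq]

theorem cons_append_singleton_palindrome {z x : Letter} {Q : Word}
    (h : (z :: (Q ++ [x])).Palindrome) : z = x ∧ Q.Palindrome := by
  have h1 := h.reverse_eq
  simp only [List.reverse_cons, List.reverse_append, List.reverse_nil, List.nil_append,
    List.cons_append, List.cons.injEq] at h1
  obtain ⟨rfl, h2⟩ := h1
  exact ⟨rfl, .of_reverse_eq (List.append_inj h2 (by simp)).1⟩

theorem IsPeriodPair.length_rightPalClosure {u : Word} {p : Letter → ℕ} (h : IsPeriodPair u p)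
    (x : Letter) : (rightPalClosure (u ++ [x])).length = u.length + p x := by
  have hpos := h.pos x
  have hle := h.le x
  have hfind : Nat.find (exists_palindrome_drop (u ++ [x])) = p x - 1 := by
    rw [Nat.find_eq_iff]
    constructor
    · by_cases hx : p x ≤ u.length
      · obtain ⟨P, t, hu, hP, hlen⟩ := h.exists_prefix x hx
        have ht : t.reverse.length = p x - 1 := by
          have := congrArg List.length hu
          simp at this ⊢
          omega
        rw [eq_reverse_append_of_palindrome h.palindrome hu hP, List.append_assoc, ← ht,
          List.drop_left]
        exact .of_reverse_eq (by simp [hP.reverse_eq])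
      · have hx' : p x - 1 = u.length := by omega
        rw [hx', List.drop_left]
        exact .singleton x
    · intro i hi hpal
      have hiu : i < u.length := by omega
      rw [List.drop_append_of_le_length hiu.le, List.drop_eq_getElem_cons hiu,
        List.cons_append] at hpal
      obtain ⟨hz, hQ⟩ := cons_append_singleton_palindrome hpal
      have hu : u = (u.take i) ++ x :: u.drop (i + 1) := by
        rw [← hz, ← List.drop_eq_getElem_cons hiu, List.take_append_drop]
      have hu' : u = u.drop (i + 1) ++ x :: (u.take i).reverse := by
        conv_lhs => rw [← h.palindrome.reverse_eq, hu]
        simp [hQ.reverse_eq]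
      have := h.maximal x _ _ hu' hQ
      simp only [List.length_drop] at this
      omega
  simp only [rightPalClosure, hfind, List.length_append, List.length_reverse, List.length_take,
    List.length_singleton]
  omega

/-- A proper palindromic prefix of the closure of `u x` is a prefix of `u`. -/
theorem length_le_of_palindrome_prefix {u P : Word} {x : Letter} (hP : P.Palindrome)
    (hpre : P <+: rightPalClosure (u ++ [x]))
    (hlt : P.length < (rightPalClosure (u ++ [x])).length) : P.length ≤ u.length := by
  obtain ⟨-, hux, hmin⟩ := (isRightPalClosure_iff (u ++ [x]) _).2 rfl
  by_contra! hc
  have := hmin P hP (List.prefix_of_prefix_length_le hux hpre (by simp; omega))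
  omega

/-- How the pair of periods changes when the palindromization map adds a letter. -/
theorem IsPeriodPair.step {u : Word} {p : Letter → ℕ} (h : IsPeriodPair u p) (x : Letter) :
    IsPeriodPair (rightPalClosure (u ++ [x])) fun z => if z = x then p x else p z + p x := by
  have hlen := h.length_rightPalClosure x
  obtain ⟨s, hs⟩ : ∃ s, rightPalClosure (u ++ [x]) = u ++ x :: s :=
    ⟨_, by rw [rightPalClosure, List.append_assoc]; rfl⟩
  refine ⟨rightPalClosure_palindrome _, fun z => ?_, fun z => ?_, fun z hz => ?_,
    fun z P t hP hpal => ?_⟩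
  · have := h.pos z
    have := h.pos x
    split_ifs <;> omega
  · have := h.le z
    split_ifs <;> omega
  · split_ifs at hz ⊢ with hzx
    · subst hzx
      exact ⟨u, s, hs, h.palindrome, hlen.symm⟩
    · obtain ⟨P, t, hu, hP, hl⟩ := h.exists_prefix z (by omega)
      refine ⟨P, t ++ x :: s, ?_, hP, by omega⟩
      rw [hs]
      conv_lhs => rw [hu]
      simp
  · have hle : P.length ≤ u.length := by
      refine length_le_of_palindrome_prefix hpal (hP ▸ List.prefix_append _ _) ?_
      rw [hP]
      simp
    split_ifs with hzx
    · omega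
    · have hlt : P.length ≠ u.length := by
        intro he
        have := (List.append_inj (hs.symm.trans hP) he.symm).2
        simp only [List.cons.injEq] at this
        exact hzx this.1.symm
      obtain ⟨r, hr⟩ : P ++ [z] <+: u := by
        refine List.prefix_of_prefix_length_le (l₃ := rightPalClosure (u ++ [x])) ?_ ?_ ?_
        · exact ⟨t, by rw [hP]; simp⟩
        · exact ⟨x :: s, hs.symm⟩
        · simp; omega
      have := h.maximal z P r (by rw [← hr]; simp) hpal
      omega

theorem IsPeriodPair.hasPeriod {u : Word} {p : Letter → ℕ} (h : IsPeriodPair u p) (z : Letter) :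
    u.HasPeriod (p z) := by
  by_cases hz : p z ≤ u.length
  · obtain ⟨P, t, hu, hP, hlen⟩ := h.exists_prefix z hz
    have hu' := eq_reverse_append_of_palindrome h.palindrome hu hP
    have hdrop : u.drop (p z) = P := by
      have ht : (t.reverse ++ [z]).length = p z := by
        have := congrArg List.length hu
        simp at this ⊢
        omega
      rw [hu', ← ht, List.append_cons _ z P, List.drop_left]
    suffices h' : P <+: u by
      have := (List.prefix_append_right_inj (u.take (p z))).2 h'
      rwa [← hdrop, List.take_append_drop] at this
    exact hu ▸ List.prefix_append _ _
  · exact List.hasPeriod_of_length_le _ _ (by omega)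

theorem IsPeriodPair.exists_le_of_hasPeriod {u : Word} {p : Letter → ℕ} (h : IsPeriodPair u p)
    {r : ℕ} (hr : 0 < r) (hper : u.HasPeriod r) : ∃ z, p z ≤ r := by
  by_cases hru : r ≤ u.length
  · obtain ⟨t, ht⟩ := hper.drop_prefix r
    have hlen := congrArg List.length ht
    simp only [List.length_append, List.length_drop] at hlen
    cases t with
    | nil => simp at hlen; omega
    | cons z t =>
      have hpal : (u.drop r).Palindrome := by
        apply List.Palindrome.of_reverse_eq
        have h1 : u.take r ++ u.drop r = (z :: t).reverse ++ (u.drop r).reverse := by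
          rw [List.take_append_drop, ← List.reverse_append, ht, h.palindrome.reverse_eq]
        exact (List.append_inj_right' h1 (by simp)).symm
      have := h.maximal z _ t ht.symm hpal
      simp only [List.length_drop] at this
      exact ⟨z, by omega⟩
  · exact ⟨.a, (h.le _).trans (by omega)⟩

theorem IsPeriodPair.minPeriod_eq {u : Word} {p : Letter → ℕ} (h : IsPeriodPair u p) {z : Letter}
    (hz : ∀ y, p z ≤ p y) : minPeriod u = p z := by
  classical
  unfold minPeriod
  rw [Nat.find_eq_iff]
  refine ⟨⟨h.pos z, h.hasPeriod z⟩, fun m hm hc => ?_⟩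
  obtain ⟨y, hy⟩ := h.exists_le_of_hasPeriod hc.1 hc.2
  have := hz y
  omega

theorem IsPeriodPair.append_replicate {v : Word} {p : Letter → ℕ} (h : IsPeriodPair (psi v) p)
    (x : Letter) (m : ℕ) :
    IsPeriodPair (psi (v ++ List.replicate m x))
      fun z => if z = x then p x else p z + m * p x := by
  induction m with
  | zero =>
    rw [List.replicate_zero, List.append_nil]
    refine h.congr fun z => ?_
    split_ifs with hz <;> simp [hz]
  | succ m ih =>
    rw [List.replicate_succ', ← List.append_assoc, psi_append_singleton]
    refine (ih.step x).congr fun z => ?_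
    by_cases hz : z = x
    · simp [hz]
    · simp only [hz, if_true, if_false]
      ring

theorem blockLetter_succ_ne (n : ℕ) : blockLetter (n + 1) ≠ blockLetter n := by
  unfold blockLetter
  by_cases hn : Even n <;> simp [hn, Nat.even_add_one]

theorem eq_blockLetter_succ {n : ℕ} {z : Letter} (h : z ≠ blockLetter n) :
    z = blockLetter (n + 1) := by
  unfold blockLetter at *
  cases z <;> by_cases hn : Even n <;> simp_all [Nat.even_add_one]

theorem isPeriodPair_psi_blockWord (α : ℕ → ℕ) (n : ℕ) :
    IsPeriodPair (psi (blockWord α n)) fun z =>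
      continuant (fun i => if i = 0 then α 0 + 1 else α i)
        (if z = blockLetter n then n else n + 1) := by
  induction n with
  | zero =>
    refine (IsPeriodPair.append_replicate (v := []) isPeriodPair_nil (blockLetter 0)
      (α 0)).congr fun z => ?_
    split_ifs
    · rfl
    · simp [continuant]
      ring
  | succ n ih =>
    refine (ih.append_replicate (blockLetter (n + 1)) (α (n + 1))).congr fun z => ?_
    by_cases hz : z = blockLetter (n + 1)
    · simp [hz, blockLetter_succ_ne]
    · have hz' : z = blockLetter n := by
        by_contra hc
        exact hz (eq_blockLetter_succ hc)
      simp [hz', (blockLetter_succ_ne n).symm, blockLetter_succ_ne, continuant]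
      ring

theorem continuant_le_succ {c : ℕ → ℕ} {n : ℕ} (h : 0 < c n) :
    continuant c n ≤ continuant c (n + 1) := by
  cases n with
  | zero => exact h
  | succ n =>
    rw [continuant]
    exact (Nat.le_mul_of_pos_left _ h).trans (Nat.le_add_right _ _)

end CentralWords

/-- If `v` has the integral representation `(α₀, …, αₙ)`, then
`π(ψ(v)) = K[α₀ + 1, α₁, …, α_{n-1}]` (`n` entries, with `K[ ] = 1` for `n = 0`). -/
theorem proposition5p5 (v : CentralWords.Word) (n : ℕ) (α : ℕ → ℕ)
    (h : CentralWords.IsIntegralRepresentation v n α) :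
    CentralWords.minPeriod (CentralWords.psi v) =
      CentralWords.continuant (fun i => if i = 0 then α 0 + 1 else α i) n := by
  obtain ⟨hpos, rfl⟩ := h
  have hc : 0 < (fun i => if i = 0 then α 0 + 1 else α i) n := by
    by_cases hn : n = 0
    · simp [hn]
    · simpa [hn] using hpos n (by omega) le_rfl
  have h := (CentralWords.isPeriodPair_psi_blockWord α n).minPeriod_eq
    (z := CentralWords.blockLetter n) fun y => by
      simp only [if_true]
      split_ifs
      · exact le_rfl
      · exact CentralWords.continuant_le_succ hc
  simpa using h
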